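/- Let $\mathcal{H}_A$ and $\mathcal{H}_B$ be nonzero finite-dimensional complex Hilbert spaces, and let $X_{AB}$ and $Y_{AB}$ be positive definite operators on $\mathcal{H}_A\otimes\mathcal{H}_B$, with partial traces $X_A=\operatorname{Tr}_B\{X_{AB}\}$ and $Y_A=\operatorname{Tr}_B\{Y_{AB}\}$. For positive definite operators $X,Y$ on the same finite-dimensional Hilbert space and $\alpha\in[1/2,1)\cup(1,\infty)$, define the sandwiched Rényi relative entropy $$\widetilde{D}_\alpha(X\Vert Y)=\frac{\alpha}{\alpha-1}\log\left\Vert Y^{(1-\alpha)/2\alpha}\,X\,Y^{(1-\alpha)/2\alpha}\right\Vert_\alpha,\qquad \Vert Z\Vert_\alpha=\left[\operatorname{Tr}\{Z^\alpha\}\right]^{1/\alpha}\ \text{ for } Z\ge 0,$$ and for $\alpha=\infty$ let $\widetilde{D}_\infty(X\Vert Y)=\log\left\Vert Y^{-1/2}XY^{-1/2}\right\Vert_\infty$, where $\Vert\cdot\Vert_\infty$ is the operator norm. Then for every $\alpha\in[1/2,1)\cup(1,\infty]$, $$\widetilde{D}_\alpha(X_{AB}\Vert Y_{AB})\ \ge\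 \widetilde{D}_\alpha(X_A\Vert Y_A).$$ -/

import Mathlib

open scoped ComplexOrder MatrixOrder ENNReal

/-- The partial trace over the second tensor factor `B` of an operator on
`ℂ^a ⊗ ℂ^b`, whose matrix is indexed by `a × b`. -/
def partialTraceB {a b : Type*} [Fintype b] (X : Matrix (a × b) (a × b) ℂ) : Matrix a a ℂ :=
  Matrix.of fun i j => ∑ k, X (i, k) (j, k)

/-- For positive semidefinite `Z`: `‖Z‖_α = (Tr Z^α)^(1/α)` when `α < ∞`, with the power `Z^α`
taken in the functional calculus, and `‖Z‖_∞` is the operator norm on the Euclidean space. -/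
noncomputable def schattenNorm {n : Type*} [Fintype n] [DecidableEq n]
    (α : ℝ≥0∞) (Z : Matrix n n ℂ) : ℝ :=
  if α = ∞ then ‖Matrix.toEuclideanCLM (n := n) (𝕜 := ℂ) Z‖
  else (Matrix.trace (CFC.rpow Z α.toReal)).re ^ (1 / α.toReal)

/-- The exponent `(1 - α) / (2 α)`, which at `α = ∞` has the limiting value `-1/2`. -/
noncomputable def sandwichExponent (α : ℝ≥0∞) : ℝ :=
  if α = ∞ then -1 / 2 else (1 - α.toReal) / (2 * α.toReal)

/-- The prefactor `α / (α - 1)`, which at `α = ∞` has the limiting value `1`. -/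
noncomputable def sandwichPrefactor (α : ℝ≥0∞) : ℝ :=
  if α = ∞ then 1 else α.toReal / (α.toReal - 1)

/-- The sandwiched Rényi relative entropy of order `α` of positive definite operators:
`α / (α - 1) * log ‖Y^((1-α)/(2α)) X Y^((1-α)/(2α))‖_α`, which at `α = ∞` reads
`log ‖Y^(-1/2) X Y^(-1/2)‖_∞`. -/
noncomputable def sandwichedRenyi {n : Type*} [Fintype n] [DecidableEq n]
    (α : ℝ≥0∞) (X Y : Matrix n n ℂ) : ℝ :=
  sandwichPrefactor α *
    Real.log (schattenNorm α
      (CFC.rpow Y (sandwichExponent α) * X * CFC.rpow Y (sandwichExponent α)))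

/-! Let Z = X^(1/2) Y^(1/α-1) X^(1/2), and let Z_A be built likewise from the partial traces. As M
Mᴴ and Mᴴ M have the same spectrum, the entropy is α/(α-1) · log (Tr Z^α)^(1/α). By Hölder for α >
1, (Tr Z^α)^(1/α) is the maximum of Tr(Z σ^(1-1/α)) over positive definite σ of trace one; by
reverse Hölder it is the minimum for α < 1. The optimum is proportional to Z^α. It therefore
suffices to lift the optimizer τ on A to some σ on AB of equal trace, with the functional moving in
the right direction (`exists_lift`).

For the lift, Tr(X^(1/2) Y^p X^(1/2) σ^(-p)) is the quadratic form of (Yᵀ ⊗ σ⁻¹)^p at vec X^(1/2).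
With W = X^(1/2) (X_A^(-1/2) ⊗ 1), the map V : vec C ↦ vec (W (C ⊗ 1)) is an isometry sending vec
X_A^(1/2) to vec X^(1/2). Taking σ = W (τ ⊗ 1) Wᴴ makes V compress Yᵀ ⊗ σ⁻¹ to Y_Aᵀ ⊗ τ⁻¹. Jensen's
operator inequality for the powers p and -p, 0 < p ≤ 1, then compares the two functionals.

At α = ∞ the entropy is the log of the least r with X ≤ rY, an order relation that the partial trace
preserves. -/

open Matrix Kronecker

/-! ### Real powers of positive definite matrices -/

/-- The functional calculus intertwines along any matrix that intertwines two diagonalized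
matrices. -/
theorem diagonal_comp_mul_eq {m n : Type*} [Fintype m] [DecidableEq m] [Fintype n] [DecidableEq n]
    {W : Matrix m n ℂ} {d : m → ℝ} {e : n → ℝ}
    (h : diagonal (fun i => (d i : ℂ)) * W = W * diagonal (fun i => (e i : ℂ))) (f : ℝ → ℝ) :
    diagonal (fun i => (f (d i) : ℂ)) * W = W * diagonal (fun i => (f (e i) : ℂ)) := by
  ext i j
  have hij := congrFun (congrFun h i) j
  rw [diagonal_mul, mul_diagonal] at hij ⊢
  by_cases hW : W i j = 0
  · simp [hW]
  · have : (d i : ℂ) = e j := mul_right_cancel₀ hW (by rw [hij, mul_comm])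
    rw [Complex.ofReal_inj.1 this, mul_comm]

theorem Matrix.IsHermitian.cfc_eq_mul_diagonal_mul {n : Type*} [Fintype n] [DecidableEq n]
    {A : Matrix n n ℂ} (hA : A.IsHermitian) (f : ℝ → ℝ) :
    cfc f A = (hA.eigenvectorUnitary : Matrix n n ℂ) *
      diagonal (fun i => (f (hA.eigenvalues i) : ℂ)) *
        (hA.eigenvectorUnitary : Matrix n n ℂ)ᴴ := by
  rw [hA.cfc_eq, IsHermitian.cfc, Unitary.conjStarAlgAut_apply]
  rfl

theorem Matrix.IsHermitian.eq_mul_diagonal_mul {n : Type*} [Fintype n] [DecidableEq n]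
    {A : Matrix n n ℂ} (hA : A.IsHermitian) :
    A = (hA.eigenvectorUnitary : Matrix n n ℂ) *
      diagonal (fun i => (hA.eigenvalues i : ℂ)) *
        (hA.eigenvectorUnitary : Matrix n n ℂ)ᴴ := by
  conv_lhs => rw [hA.spectral_theorem, Unitary.conjStarAlgAut_apply]
  rfl

theorem Matrix.IsHermitian.eigenvectorUnitary_conjTranspose_mul {n : Type*} [Fintype n]
    [DecidableEq n] {A : Matrix n n ℂ} (hA : A.IsHermitian) :
    (hA.eigenvectorUnitary : Matrix n n ℂ)ᴴ * (hA.eigenvectorUnitary : Matrix n n ℂ) = 1 :=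
  Unitary.coe_star_mul_self hA.eigenvectorUnitary

theorem Matrix.IsHermitian.eigenvectorUnitary_mul_conjTranspose {n : Type*} [Fintype n]
    [DecidableEq n] {A : Matrix n n ℂ} (hA : A.IsHermitian) :
    (hA.eigenvectorUnitary : Matrix n n ℂ) * (hA.eigenvectorUnitary : Matrix n n ℂ)ᴴ = 1 :=
  Unitary.coe_mul_star_self hA.eigenvectorUnitary

theorem isHermitian_mul_diagonal_mul {n : Type*} [Fintype n] [DecidableEq n]
    (U : Matrix n n ℂ) (d : n → ℝ) :
    (U * diagonal (fun i => (d i : ℂ)) * Uᴴ).IsHermitian := by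
  apply isHermitian_mul_mul_conjTranspose
  rw [IsHermitian, diagonal_conjTranspose]
  congr 1
  ext i
  simp

/-- Any unitary diagonalization computes the functional calculus: the change of basis to the chosen
eigenvectors only links equal eigenvalues, so it also intertwines their images under `f`. -/
theorem cfc_mul_diagonal_mul {n : Type*} [Fintype n] [DecidableEq n] {U : Matrix n n ℂ}
    (hU : Uᴴ * U = 1) (d : n → ℝ) (f : ℝ → ℝ) :
    cfc f (U * diagonal (fun i => (d i : ℂ)) * Uᴴ) =
      U * diagonal (fun i => (f (d i) : ℂ)) * Uᴴ := by
  have hU' : U * Uᴴ = 1 := mul_eq_one_comm.1 hU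
  set A := U * diagonal (fun i => (d i : ℂ)) * Uᴴ with hAdef
  have hA : A.IsHermitian := isHermitian_mul_diagonal_mul U d
  rw [hA.cfc_eq_mul_diagonal_mul]
  set V := (hA.eigenvectorUnitary : Matrix n n ℂ)
  have hV : Vᴴ * V = 1 := hA.eigenvectorUnitary_conjTranspose_mul
  have hV' : V * Vᴴ = 1 := hA.eigenvectorUnitary_mul_conjTranspose
  have h1 : diagonal (fun i => (d i : ℂ)) * (Uᴴ * V) =
      (Uᴴ * V) * diagonal (fun i => (hA.eigenvalues i : ℂ)) := by
    calc diagonal (fun i => (d i : ℂ)) * (Uᴴ * V)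
        = (Uᴴ * U) * diagonal (fun i => (d i : ℂ)) * (Uᴴ * V) := by rw [hU, one_mul]
      _ = Uᴴ * A * V := by rw [hAdef]; simp only [Matrix.mul_assoc]
      _ = Uᴴ * (V * diagonal (fun i => (hA.eigenvalues i : ℂ)) * Vᴴ) * V := by
        rw [← hA.eq_mul_diagonal_mul]
      _ = (Uᴴ * V) * diagonal (fun i => (hA.eigenvalues i : ℂ)) * (Vᴴ * V) := by
        simp only [Matrix.mul_assoc]
      _ = _ := by rw [hV, mul_one]
  have h2 := diagonal_comp_mul_eq h1 f
  calc _ = (U * Uᴴ) * V * diagonal (fun i => (f (hA.eigenvalues i) : ℂ)) * Vᴴ := by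
        rw [hU', one_mul]
    _ = U * ((Uᴴ * V) * diagonal (fun i => (f (hA.eigenvalues i) : ℂ))) * Vᴴ := by
        simp only [Matrix.mul_assoc]
    _ = U * diagonal (fun i => (f (d i) : ℂ)) * Uᴴ * (V * Vᴴ) := by
        rw [← h2]; simp only [Matrix.mul_assoc]
    _ = _ := by rw [hV', mul_one]

theorem Matrix.PosDef.rpow_eq_cfc {n : Type*} [Fintype n] [DecidableEq n] {A : Matrix n n ℂ}
    (hA : A.PosDef) (s : ℝ) : CFC.rpow A s = cfc (fun x : ℝ => x ^ s) A :=
  CFC.rpow_eq_cfc_real (a := A) (y := s) (Matrix.nonneg_iff_posSemidef.2 hA.posSemidef)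

theorem Matrix.PosDef.exists_diagonalization {n : Type*} [Fintype n] [DecidableEq n]
    {A : Matrix n n ℂ} (hA : A.PosDef) :
    ∃ (U : Matrix n n ℂ) (d : n → ℝ), Uᴴ * U = 1 ∧ (∀ i, 0 < d i) ∧
      A = U * diagonal (fun i => (d i : ℂ)) * Uᴴ ∧
      ∀ f : ℝ → ℝ, cfc f A = U * diagonal (fun i => (f (d i) : ℂ)) * Uᴴ :=
  ⟨_, _, hA.isHermitian.eigenvectorUnitary_conjTranspose_mul, hA.eigenvalues_pos,
    hA.isHermitian.eq_mul_diagonal_mul, hA.isHermitian.cfc_eq_mul_diagonal_mul⟩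

theorem posDef_mul_diagonal_mul {n : Type*} [Fintype n] [DecidableEq n] {U : Matrix n n ℂ}
    (hU : Uᴴ * U = 1) {d : n → ℝ} (hd : ∀ i, 0 < d i) :
    (U * diagonal (fun i => (d i : ℂ)) * Uᴴ).PosDef := by
  have h : (diagonal (fun i => (d i : ℂ))).PosDef :=
    PosDef.diagonal fun i => by exact_mod_cast hd i
  refine h.mul_mul_conjTranspose_same (vecMul_injective_of_isUnit ?_)
  exact (isUnit_iff_isUnit_det _).2 (Matrix.isUnit_det_of_left_inverse hU)

theorem Matrix.PosDef.rpow {n : Type*} [Fintype n] [DecidableEq n] {A : Matrix n n ℂ}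
    (hA : A.PosDef) (s : ℝ) : (CFC.rpow A s).PosDef := by
  obtain ⟨U, d, hU, hd, -, hf⟩ := hA.exists_diagonalization
  rw [hA.rpow_eq_cfc, hf]
  exact posDef_mul_diagonal_mul hU fun i => Real.rpow_pos_of_pos (hd i) s

theorem Matrix.PosDef.rpow_add {n : Type*} [Fintype n] [DecidableEq n] {A : Matrix n n ℂ}
    (hA : A.PosDef) (s t : ℝ) : CFC.rpow A s * CFC.rpow A t = CFC.rpow A (s + t) := by
  obtain ⟨U, d, hU, hd, -, hf⟩ := hA.exists_diagonalization
  simp only [hA.rpow_eq_cfc, hf]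
  calc _ = U * diagonal (fun i => ((d i ^ s : ℝ) : ℂ)) * (Uᴴ * U) *
        diagonal (fun i => ((d i ^ t : ℝ) : ℂ)) * Uᴴ := by simp only [Matrix.mul_assoc]
    _ = _ := by
      rw [hU, mul_one, Matrix.mul_assoc U, diagonal_mul_diagonal]
      simp_rw [Real.rpow_add (hd _), Complex.ofReal_mul]

theorem Matrix.PosDef.rpow_one {n : Type*} [Fintype n] [DecidableEq n] {A : Matrix n n ℂ}
    (hA : A.PosDef) : CFC.rpow A 1 = A :=
  CFC.rpow_one A (Matrix.nonneg_iff_posSemidef.2 hA.posSemidef)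

theorem Matrix.PosDef.rpow_zero {n : Type*} [Fintype n] [DecidableEq n] {A : Matrix n n ℂ}
    (hA : A.PosDef) : CFC.rpow A 0 = 1 :=
  CFC.rpow_zero A (Matrix.nonneg_iff_posSemidef.2 hA.posSemidef)

theorem Matrix.PosDef.rpow_rpow {n : Type*} [Fintype n] [DecidableEq n] {A : Matrix n n ℂ}
    (hA : A.PosDef) (s t : ℝ) : CFC.rpow (CFC.rpow A s) t = CFC.rpow A (s * t) := by
  obtain ⟨U, d, hU, hd, -, hf⟩ := hA.exists_diagonalization
  rw [(hA.rpow s).rpow_eq_cfc, hA.rpow_eq_cfc, hA.rpow_eq_cfc, hf, hf, cfc_mul_diagonal_mul hU]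
  simp_rw [Real.rpow_mul (hd _).le]

theorem Matrix.PosDef.rpow_neg_one {n : Type*} [Fintype n] [DecidableEq n] {A : Matrix n n ℂ}
    (hA : A.PosDef) : CFC.rpow A (-1) = A⁻¹ := by
  symm
  apply inv_eq_left_inv
  nth_rewrite 2 [← hA.rpow_one]
  rw [hA.rpow_add, neg_add_cancel, hA.rpow_zero]

theorem Matrix.PosDef.rpow_transpose {n : Type*} [Fintype n] [DecidableEq n] {A : Matrix n n ℂ}
    (hA : A.PosDef) (s : ℝ) : CFC.rpow Aᵀ s = (CFC.rpow A s)ᵀ := by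
  obtain ⟨U, d, hU, hd, hA', hf⟩ := hA.exists_diagonalization
  rw [hA.transpose.rpow_eq_cfc, hA.rpow_eq_cfc, hf]
  nth_rewrite 1 [hA']
  have key : ∀ D : Matrix n n ℂ, (U * D * Uᴴ)ᵀ = (Uᴴᵀ * Dᵀ * Uᴴᵀᴴ) := by
    intro D
    simp only [transpose_mul, Matrix.mul_assoc]
    rw [conjTranspose_transpose]
    congr 2
    ext
    simp
  have hV : Uᴴᵀᴴ * Uᴴᵀ = 1 := by
    have : Uᴴᵀᴴ = Uᵀ := by ext; simp
    rw [this, ← transpose_mul, hU, transpose_one]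
  rw [key, key, diagonal_transpose, diagonal_transpose, cfc_mul_diagonal_mul hV]

theorem Matrix.PosDef.rpow_kronecker {m n : Type*} [Fintype m] [DecidableEq m] [Fintype n]
    [DecidableEq n] {A : Matrix m m ℂ} {B : Matrix n n ℂ} (hA : A.PosDef) (hB : B.PosDef) (s : ℝ) :
    CFC.rpow (A ⊗ₖ B) s = CFC.rpow A s ⊗ₖ CFC.rpow B s := by
  obtain ⟨U, d, hU, hd, hA', hf⟩ := hA.exists_diagonalization
  obtain ⟨V, e, hV, he, hB', hg⟩ := hB.exists_diagonalization
  have key : ∀ (d : m → ℝ) (e : n → ℝ), (U * diagonal (fun i => (d i : ℂ)) * Uᴴ) ⊗ₖ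
      (V * diagonal (fun i => (e i : ℂ)) * Vᴴ) =
      (U ⊗ₖ V) * diagonal (fun i : m × n => ((d i.1 * e i.2 : ℝ) : ℂ)) * (U ⊗ₖ V)ᴴ := by
    intro d e
    rw [mul_kronecker_mul, mul_kronecker_mul, diagonal_kronecker_diagonal,
      conjTranspose_kronecker]
    simp
  have hUV : (U ⊗ₖ V)ᴴ * (U ⊗ₖ V) = 1 := by
    rw [conjTranspose_kronecker, ← mul_kronecker_mul, hU, hV, one_kronecker_one]
  rw [(hA.kronecker hB).rpow_eq_cfc, hA.rpow_eq_cfc, hB.rpow_eq_cfc, hf, hg, key]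
  nth_rewrite 1 [hA']
  nth_rewrite 1 [hB']
  rw [key, cfc_mul_diagonal_mul hUV]
  simp_rw [Real.mul_rpow (hd _).le (he _).le]

/-- Expressing the trace through the characteristic polynomial makes it visibly the same for `A * B`
and `B * A`. -/
theorem Matrix.IsHermitian.trace_cfc {n : Type*} [Fintype n] [DecidableEq n] {A : Matrix n n ℂ}
    (hA : A.IsHermitian) (f : ℝ → ℝ) :
    (cfc f A).trace = (A.charpoly.roots.map fun z => (f z.re : ℂ)).sum := by
  rw [hA.cfc_eq_mul_diagonal_mul, trace_mul_comm, ← Matrix.mul_assoc,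
    hA.eigenvectorUnitary_conjTranspose_mul, one_mul, trace_diagonal,
    hA.roots_charpoly_eq_eigenvalues]
  simp

theorem Matrix.PosDef.trace_rpow_mul_comm {n : Type*} [Fintype n] [DecidableEq n]
    {A B : Matrix n n ℂ} (hAB : (A * B).PosDef) (hBA : (B * A).PosDef) (s : ℝ) :
    (CFC.rpow (A * B) s).trace = (CFC.rpow (B * A) s).trace := by
  rw [hAB.rpow_eq_cfc, hBA.rpow_eq_cfc, hAB.isHermitian.trace_cfc, hBA.isHermitian.trace_cfc,
    charpoly_mul_comm]

/-! ### Jensen's operator inequality for powers -/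

theorem Matrix.PosDef.inv_mul_self {n : Type*} [Fintype n] [DecidableEq n] {A : Matrix n n ℂ}
    (hA : A.PosDef) : A⁻¹ * A = 1 :=
  nonsing_inv_mul A ((isUnit_iff_isUnit_det A).1 hA.isUnit)

theorem Matrix.PosDef.mul_inv_self {n : Type*} [Fintype n] [DecidableEq n] {A : Matrix n n ℂ}
    (hA : A.PosDef) : A * A⁻¹ = 1 :=
  mul_nonsing_inv A ((isUnit_iff_isUnit_det A).1 hA.isUnit)

theorem mulVec_injective_of_conjTranspose_mul {m n : Type*} [Fintype m] [Fintype n]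
    [DecidableEq n] {V : Matrix m n ℂ} (hV : Vᴴ * V = 1) : Function.Injective V.mulVec := by
  intro x y h
  have := congrArg (Vᴴ *ᵥ ·) h
  simpa [mulVec_mulVec, hV] using this

theorem Matrix.PosDef.rpow_neg {n : Type*} [Fintype n] [DecidableEq n] {A : Matrix n n ℂ}
    (hA : A.PosDef) (p : ℝ) : CFC.rpow A (-p) = (CFC.rpow A p)⁻¹ := by
  rw [← (hA.rpow p).rpow_neg_one, hA.rpow_rpow, mul_neg_one]

/-- Compression by an isometry and inversion: `(Vᴴ M V)⁻¹ ≤ Vᴴ M⁻¹ V`. -/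
theorem Matrix.PosDef.posSemidef_compression_inv_sub {m n : Type*} [Fintype m] [DecidableEq m]
    [Fintype n] [DecidableEq n] {M : Matrix m m ℂ} (hM : M.PosDef) {V : Matrix m n ℂ}
    (hV : Vᴴ * V = 1) : (Vᴴ * M⁻¹ * V - (Vᴴ * M * V)⁻¹).PosSemidef := by
  have hN : (Vᴴ * M * V).PosDef :=
    hM.conjTranspose_mul_mul_same (mulVec_injective_of_conjTranspose_mul hV)
  -- Completing the square: with N = Vᴴ M V and T = V - M V N⁻¹, the difference is exactly Tᴴ M⁻¹ T.
  have h := hM.inv.posSemidef.conjTranspose_mul_mul_same (V - M * V * (Vᴴ * M * V)⁻¹)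
  have hN1 := hN.mul_inv_self
  suffices e : Vᴴ * M⁻¹ * V - (Vᴴ * M * V)⁻¹ =
      (V - M * V * (Vᴴ * M * V)⁻¹)ᴴ * M⁻¹ * (V - M * V * (Vᴴ * M * V)⁻¹) by rwa [e]
  have hNh : (Vᴴ * M * V)⁻¹ᴴ = (Vᴴ * M * V)⁻¹ := hN.inv.isHermitian
  have hMh : Mᴴ = M := hM.isHermitian
  rw [conjTranspose_sub, conjTranspose_mul, conjTranspose_mul, hNh, hMh]
  set K := (Vᴴ * M * V)⁻¹
  have e1 : K * (Vᴴ * M) * M⁻¹ * V = K := by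
    calc _ = K * Vᴴ * (M * M⁻¹) * V := by simp only [Matrix.mul_assoc]
      _ = K := by rw [hM.mul_inv_self, Matrix.mul_one, Matrix.mul_assoc, hV, Matrix.mul_one]
  have e2 : Vᴴ * M⁻¹ * (M * V * K) = K := by
    calc _ = Vᴴ * (M⁻¹ * M) * V * K := by simp only [Matrix.mul_assoc]
      _ = K := by rw [hM.inv_mul_self, Matrix.mul_one, hV, Matrix.one_mul]
  have e3 : K * (Vᴴ * M) * M⁻¹ * (M * V * K) = K := by
    calc _ = K * Vᴴ * M * (M⁻¹ * M) * V * K := by simp only [Matrix.mul_assoc]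
      _ = K * (Vᴴ * M * V * K) := by
        rw [hM.inv_mul_self, Matrix.mul_one]; simp only [Matrix.mul_assoc]
      _ = K := by rw [hN1, Matrix.mul_one]
  rw [Matrix.sub_mul, Matrix.sub_mul, Matrix.mul_sub, Matrix.mul_sub, e1, e2, e3]
  abel

theorem Matrix.PosDef.posSemidef_inv_sub_inv {n : Type*} [Fintype n] [DecidableEq n]
    {A B : Matrix n n ℂ} (hA : A.PosDef) (hB : B.PosDef) (h : (B - A).PosSemidef) :
    (A⁻¹ - B⁻¹).PosSemidef := by
  have h1 := hA.posSemidef.mul_mul_conjTranspose_same (A⁻¹ - B⁻¹)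
  have h2 := h.mul_mul_conjTranspose_same B⁻¹
  suffices e : A⁻¹ - B⁻¹ = (A⁻¹ - B⁻¹) * A * (A⁻¹ - B⁻¹)ᴴ + B⁻¹ * (B - A) * B⁻¹ᴴ by
    rw [e]
    exact h1.add h2
  rw [conjTranspose_sub, hA.inv.isHermitian.eq, hB.inv.isHermitian.eq]
  have e1 : A⁻¹ * A = 1 := hA.inv_mul_self
  have e2 : B⁻¹ * B = 1 := hB.inv_mul_self
  have e3 : A * A⁻¹ = 1 := hA.mul_inv_self
  have e4 : B⁻¹ * A * A⁻¹ = B⁻¹ := by rw [Matrix.mul_assoc, e3, Matrix.mul_one]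
  simp only [Matrix.sub_mul, Matrix.mul_sub, e1, e2, e4, Matrix.one_mul]
  abel

/-- The spectral measure of `A` at `v`. Its weights do not depend on `f`, so integral formulas for
powers need only scalar integrals. -/
theorem exists_quadraticForm_cfc_eq_sum {n : Type*} [Fintype n] [DecidableEq n]
    {A : Matrix n n ℂ} (hA : A.PosDef) (v : n → ℂ) :
    ∃ w d : n → ℝ, (∀ i, 0 < d i) ∧
      ∀ f : ℝ → ℝ, (star v ⬝ᵥ (cfc f A *ᵥ v)).re = ∑ i, w i * f (d i) := by
  obtain ⟨U, d, hU, hd, -, hf⟩ := hA.exists_diagonalization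
  refine ⟨fun i => Complex.normSq ((Uᴴ *ᵥ v) i), d, hd, fun f => ?_⟩
  have : star v ⬝ᵥ (cfc f A *ᵥ v) =
      star (Uᴴ *ᵥ v) ⬝ᵥ (diagonal (fun i => (f (d i) : ℂ)) *ᵥ (Uᴴ *ᵥ v)) := by
    rw [hf, star_mulVec, conjTranspose_conjTranspose, ← dotProduct_mulVec, mulVec_mulVec,
      mulVec_mulVec, Matrix.mul_assoc]
  rw [this, dotProduct, Complex.re_sum]
  refine Finset.sum_congr rfl fun i _ => ?_
  rw [mulVec_diagonal]
  simp only [Pi.star_apply, Complex.star_def, Complex.normSq_apply, Complex.mul_re,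
    Complex.mul_im, Complex.conj_re, Complex.conj_im, Complex.ofReal_re, Complex.ofReal_im]
  ring

/-- The integrand is t^p (t⁻¹ - (t + x)⁻¹), so operator inequalities for powers reduce to
inequalities for resolvents. -/
theorem cfc_rpowIntegrand_eq {n : Type*} [Fintype n] [DecidableEq n] {A : Matrix n n ℂ}
    (hA : A.PosDef) (p : ℝ) {t : ℝ} (ht : 0 < t) :
    cfc (Real.rpowIntegrand₀₁ p t) A =
      ((t ^ p : ℝ) : ℂ) • (((t⁻¹ : ℝ) : ℂ) • (1 : Matrix n n ℂ) - ((t : ℂ) • 1 + A)⁻¹) := by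
  obtain ⟨U, d, hU, hd, hA', hf⟩ := hA.exists_diagonalization
  have hU' : U * Uᴴ = 1 := mul_eq_one_comm.1 hU
  have hone : ∀ c : ℂ, c • (1 : Matrix n n ℂ) = U * diagonal (fun _ => c) * Uᴴ := by
    intro c
    have : diagonal (fun _ : n => c) = c • (1 : Matrix n n ℂ) := by
      rw [smul_one_eq_diagonal]
    rw [this, Matrix.mul_smul, Matrix.smul_mul, Matrix.mul_one, hU']
  have hinv : ((t : ℂ) • 1 + A)⁻¹ = U * diagonal (fun i => (((t + d i)⁻¹ : ℝ) : ℂ)) * Uᴴ := by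
    apply inv_eq_left_inv
    rw [hone]
    nth_rewrite 1 [hA']
    rw [← Matrix.add_mul, ← Matrix.mul_add, diagonal_add]
    calc _ = U * diagonal (fun i => (((t + d i)⁻¹ : ℝ) : ℂ)) * (Uᴴ * U) *
          diagonal (fun i => (t : ℂ) + d i) * Uᴴ := by simp only [Matrix.mul_assoc]
      _ = U * diagonal (fun _ => (1 : ℂ)) * Uᴴ := by
        rw [hU, Matrix.mul_one, Matrix.mul_assoc U, diagonal_mul_diagonal]
        congr 3
        ext i
        have : (t : ℂ) + d i ≠ 0 := by exact_mod_cast (add_pos ht (hd i)).ne'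
        push_cast
        exact inv_mul_cancel₀ this
      _ = 1 := by rw [← hone, one_smul]
  rw [hf, hinv, hone, ← Matrix.sub_mul, ← Matrix.mul_sub, diagonal_sub, ← Matrix.smul_mul,
    ← Matrix.mul_smul, ← diagonal_smul]
  congr 3
  ext i
  simp [Real.rpowIntegrand₀₁]

open MeasureTheory Set in
theorem sum_mul_rpow_eq_integral {μ : Measure ℝ} {p : ℝ}
    (hμ : ∀ x ∈ Ici (0 : ℝ), IntegrableOn (fun t => Real.rpowIntegrand₀₁ p t x) (Ioi 0) μ ∧
      x ^ p = ∫ t in Ioi 0, Real.rpowIntegrand₀₁ p t x ∂μ)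
    {ι : Type*} [Fintype ι] (w : ι → ℝ) {d : ι → ℝ} (hd : ∀ i, 0 < d i) :
    IntegrableOn (fun t => ∑ i, w i * Real.rpowIntegrand₀₁ p t (d i)) (Ioi 0) μ ∧
      ∑ i, w i * d i ^ p = ∫ t in Ioi 0, ∑ i, w i * Real.rpowIntegrand₀₁ p t (d i) ∂μ := by
  have hi : ∀ i ∈ Finset.univ,
      IntegrableOn (fun t => w i * Real.rpowIntegrand₀₁ p t (d i)) (Ioi 0) μ :=
    fun i _ => (hμ _ (hd i).le).1.const_mul _
  refine ⟨integrable_finsetSum _ hi, ?_⟩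
  rw [integral_finsetSum _ hi]
  simp_rw [integral_const_mul, ← (hμ _ (hd _).le).2]

open MeasureTheory Set in
/-- Jensen's operator inequality for the powers `0 < p < 1`, as quadratic forms. -/
theorem quadraticForm_rpow_compression_le {m n : Type*} [Fintype m] [DecidableEq m]
    [Fintype n] [DecidableEq n] {M : Matrix m m ℂ} (hM : M.PosDef) {V : Matrix m n ℂ}
    (hV : Vᴴ * V = 1) {p : ℝ} (hp : p ∈ Ioo (0 : ℝ) 1) (v : n → ℂ) :
    (star (V *ᵥ v) ⬝ᵥ (CFC.rpow M p *ᵥ (V *ᵥ v))).re ≤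
      (star v ⬝ᵥ (CFC.rpow (Vᴴ * M * V) p *ᵥ v)).re := by
  have hN : (Vᴴ * M * V).PosDef :=
    hM.conjTranspose_mul_mul_same (mulVec_injective_of_conjTranspose_mul hV)
  obtain ⟨μ, hμ⟩ := Real.exists_measure_rpow_eq_integral_rpowIntegrand₀₁ hp
  obtain ⟨w, d, hd, hf⟩ := exists_quadraticForm_cfc_eq_sum hM (V *ᵥ v)
  obtain ⟨u, e, he, hg⟩ := exists_quadraticForm_cfc_eq_sum hN v
  rw [hM.rpow_eq_cfc, hN.rpow_eq_cfc, hf, hg]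
  obtain ⟨i1, i2⟩ := sum_mul_rpow_eq_integral hμ w hd
  obtain ⟨j1, j2⟩ := sum_mul_rpow_eq_integral hμ u he
  rw [i2, j2]
  -- Compare the integrands at each t: the t⁻¹ terms agree because V is an isometry, and the
  -- resolvents are ordered by the inverse compression inequality for t + M.
  refine setIntegral_mono_on i1 j1 measurableSet_Ioi fun t ht => ?_
  rw [mem_Ioi] at ht
  rw [← hf, ← hg, cfc_rpowIntegrand_eq hM p ht, cfc_rpowIntegrand_eq hN p ht]
  have hMt : ((t : ℂ) • 1 + M).PosDef := by
    refine PosDef.add ?_ hM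
    exact PosDef.one.smul (by exact_mod_cast ht)
  have hcomp : Vᴴ * ((t : ℂ) • 1 + M) * V = (t : ℂ) • 1 + Vᴴ * M * V := by
    rw [Matrix.mul_add, Matrix.add_mul, Matrix.mul_smul, Matrix.smul_mul, Matrix.mul_one, hV]
  have h := (hMt.posSemidef_compression_inv_sub hV)
  rw [hcomp] at h
  have h2 := (Complex.nonneg_iff.1 (h.dotProduct_mulVec_nonneg v)).1
  have e1 : star (V *ᵥ v) ⬝ᵥ (((t : ℂ) • 1 + M)⁻¹ *ᵥ (V *ᵥ v)) =
      star v ⬝ᵥ ((Vᴴ * ((t : ℂ) • 1 + M)⁻¹ * V) *ᵥ v) := by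
    rw [star_mulVec, ← dotProduct_mulVec, mulVec_mulVec, mulVec_mulVec, Matrix.mul_assoc]
  have e2 : star (V *ᵥ v) ⬝ᵥ (V *ᵥ v) = star v ⬝ᵥ v := by
    rw [star_mulVec, ← dotProduct_mulVec, mulVec_mulVec, hV, one_mulVec]
  simp only [smul_mulVec, sub_mulVec, one_mulVec, dotProduct_smul, dotProduct_sub, e1, e2,
    smul_eq_mul, Complex.re_ofReal_mul, Complex.sub_re] at h2 ⊢
  have : 0 ≤ t ^ p := (Real.rpow_pos_of_pos ht p).le
  exact mul_le_mul_of_nonneg_left (by linarith) this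

/-- Jensen's operator inequality `Vᴴ M ^ p V ≤ (Vᴴ M V) ^ p` for isometries `V`. -/
theorem posSemidef_rpow_compression_sub {m n : Type*} [Fintype m] [DecidableEq m]
    [Fintype n] [DecidableEq n] {M : Matrix m m ℂ} (hM : M.PosDef) {V : Matrix m n ℂ}
    (hV : Vᴴ * V = 1) {p : ℝ} (hp : p ∈ Set.Ioc (0 : ℝ) 1) :
    (CFC.rpow (Vᴴ * M * V) p - Vᴴ * CFC.rpow M p * V).PosSemidef := by
  have hinj := mulVec_injective_of_conjTranspose_mul hV
  have hN : (Vᴴ * M * V).PosDef := hM.conjTranspose_mul_mul_same hinj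
  -- The integral representation needs p < 1; at p = 1, needed for α = 1/2, both sides coincide.
  rcases hp.2.eq_or_lt with rfl | hp1
  · rw [hM.rpow_one, hN.rpow_one, sub_self]
    exact PosSemidef.zero
  have hher : (CFC.rpow (Vᴴ * M * V) p - Vᴴ * CFC.rpow M p * V).IsHermitian :=
    (hN.rpow p).isHermitian.sub ((hM.rpow p).conjTranspose_mul_mul_same hinj).isHermitian
  refine .of_dotProduct_mulVec_nonneg hher fun v => Complex.nonneg_iff.2 ⟨?_, ?_⟩
  · have h := quadraticForm_rpow_compression_le hM hV ⟨hp.1, hp1⟩ v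
    have e1 : star (V *ᵥ v) ⬝ᵥ (CFC.rpow M p *ᵥ (V *ᵥ v)) =
        star v ⬝ᵥ ((Vᴴ * CFC.rpow M p * V) *ᵥ v) := by
      rw [star_mulVec, ← dotProduct_mulVec, mulVec_mulVec, mulVec_mulVec, Matrix.mul_assoc]
    rw [sub_mulVec, dotProduct_sub, Complex.sub_re, ← e1]
    linarith
  · have := hher.im_star_dotProduct_mulVec_self v
    exact this.symm

/-- Jensen's operator inequality `(Vᴴ M V) ^ (-p) ≤ Vᴴ M ^ (-p) V` for isometries `V`. -/
theorem posSemidef_compression_rpow_neg_sub {m n : Type*} [Fintype m] [DecidableEq m]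
    [Fintype n] [DecidableEq n] {M : Matrix m m ℂ} (hM : M.PosDef) {V : Matrix m n ℂ}
    (hV : Vᴴ * V = 1) {p : ℝ} (hp : p ∈ Set.Ioc (0 : ℝ) 1) :
    (Vᴴ * CFC.rpow M (-p) * V - CFC.rpow (Vᴴ * M * V) (-p)).PosSemidef := by
  have hinj := mulVec_injective_of_conjTranspose_mul hV
  have hN : (Vᴴ * M * V).PosDef := hM.conjTranspose_mul_mul_same hinj
  -- Chain Vᴴ M^(-p) V ≥ (Vᴴ M^p V)⁻¹ ≥ (Vᴴ M V)^(-p), the second step by antitonicity of the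
  -- inverse.
  have h1 := (hM.rpow p).posSemidef_compression_inv_sub hV
  have h2 := ((hM.rpow p).conjTranspose_mul_mul_same hinj).posSemidef_inv_sub_inv (hN.rpow p)
    (posSemidef_rpow_compression_sub hM hV hp)
  rw [hM.rpow_neg, hN.rpow_neg]
  simpa using h1.add h2

/-! ### Hölder and reverse Hölder inequalities for traces -/

theorem sum_normSq_apply_right {n : Type*} [Fintype n] [DecidableEq n] {W : Matrix n n ℂ}
    (hW : W * Wᴴ = 1) (i : n) : ∑ j, Complex.normSq (W i j) = 1 := by
  have h := congrFun (congrFun hW i) i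
  rw [mul_apply, one_apply_eq] at h
  have h2 : ((∑ j, Complex.normSq (W i j) : ℝ) : ℂ) = 1 := by
    rw [← h]
    push_cast
    exact Finset.sum_congr rfl fun j _ => by
      rw [conjTranspose_apply, Complex.star_def, Complex.mul_conj]
  exact_mod_cast h2

theorem sum_normSq_apply_left {n : Type*} [Fintype n] [DecidableEq n] {W : Matrix n n ℂ}
    (hW : Wᴴ * W = 1) (j : n) : ∑ i, Complex.normSq (W i j) = 1 := by
  have h := sum_normSq_apply_right (W := Wᴴ) (by rwa [conjTranspose_conjTranspose]) j
  simpa [conjTranspose_apply] using h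

theorem re_trace_mul_diagonal_mul {n : Type*} [Fintype n] [DecidableEq n]
    (U V : Matrix n n ℂ) (f g : n → ℝ) :
    (U * diagonal (fun i => (f i : ℂ)) * Uᴴ * (V * diagonal (fun i => (g i : ℂ)) * Vᴴ)).trace.re =
      ∑ i, ∑ j, Complex.normSq ((Uᴴ * V) i j) * (f i * g j) := by
  have h : (U * diagonal (fun i => (f i : ℂ)) * Uᴴ *
      (V * diagonal (fun i => (g i : ℂ)) * Vᴴ)).trace =
      (diagonal (fun i => (f i : ℂ)) * (Uᴴ * V) *
        (diagonal (fun i => (g i : ℂ)) * (Uᴴ * V)ᴴ)).trace := by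
    rw [Matrix.mul_assoc U, Matrix.mul_assoc U, trace_mul_comm U, conjTranspose_mul,
      conjTranspose_conjTranspose]
    simp only [Matrix.mul_assoc]
  rw [h, trace, Complex.re_sum]
  refine Finset.sum_congr rfl fun i _ => ?_
  rw [diag_apply, mul_apply, Complex.re_sum]
  refine Finset.sum_congr rfl fun j _ => ?_
  rw [diagonal_mul, diagonal_mul, conjTranspose_apply, Complex.star_def, Complex.normSq_apply]
  simp only [Complex.mul_re, Complex.mul_im, Complex.conj_re, Complex.conj_im,
    Complex.ofReal_re, Complex.ofReal_im]
  ring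

/-- The trace of `P ^ r * Q ^ t` is a doubly stochastic average of products of eigenvalues. -/
theorem exists_trace_rpow_mul_rpow_eq_sum {n : Type*} [Fintype n] [DecidableEq n]
    {P Q : Matrix n n ℂ} (hP : P.PosDef) (hQ : Q.PosDef) :
    ∃ (c : n → n → ℝ) (x y : n → ℝ), (∀ i j, 0 ≤ c i j) ∧ (∀ i, 0 < x i) ∧ (∀ j, 0 < y j) ∧
      (∀ i, ∑ j, c i j = 1) ∧ (∀ j, ∑ i, c i j = 1) ∧ P.trace.re = ∑ i, x i ∧
      Q.trace.re = ∑ j, y j ∧ ∀ r t : ℝ, (CFC.rpow P r * CFC.rpow Q t).trace.re =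
        ∑ i, ∑ j, c i j * (x i ^ r * y j ^ t) := by
  obtain ⟨U, x, hU, hx, hP', hf⟩ := hP.exists_diagonalization
  obtain ⟨V, y, hV, hy, hQ', hg⟩ := hQ.exists_diagonalization
  have hU' : U * Uᴴ = 1 := mul_eq_one_comm.1 hU
  have hW : (Uᴴ * V)ᴴ * (Uᴴ * V) = 1 := by
    rw [conjTranspose_mul, conjTranspose_conjTranspose, Matrix.mul_assoc, ← Matrix.mul_assoc U,
      hU', Matrix.one_mul, hV]
  refine ⟨fun i j => Complex.normSq ((Uᴴ * V) i j), x, y, fun i j => Complex.normSq_nonneg _,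
    hx, hy, sum_normSq_apply_right (mul_eq_one_comm.1 hW), sum_normSq_apply_left hW, ?_, ?_, ?_⟩
  · rw [hP', trace_mul_comm, ← Matrix.mul_assoc, hU, Matrix.one_mul, trace_diagonal,
      Complex.re_sum]
    simp
  · rw [hQ', trace_mul_comm, ← Matrix.mul_assoc, hV, Matrix.one_mul, trace_diagonal,
      Complex.re_sum]
    simp
  · intro r t
    rw [hP.rpow_eq_cfc, hQ.rpow_eq_cfc, hf, hg, re_trace_mul_diagonal_mul]

theorem rpow_mul_rpow_one_sub_eq {x y : ℝ} (hx : 0 < x) (hy : 0 < y) (r : ℝ) :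
    x ^ r * y ^ (1 - r) = y * (1 + (x / y - 1)) ^ r := by
  rw [add_sub_cancel, Real.div_rpow hx.le hy.le, Real.rpow_sub hy, Real.rpow_one]
  ring

/-- Bernoulli's inequality at x / y - 1; for exponents at least 1 it reverses, which gives the
companion bound. -/
theorem rpow_mul_rpow_one_sub_le {x y : ℝ} (hx : 0 < x) (hy : 0 < y) {r : ℝ} (h0 : 0 ≤ r)
    (h1 : r ≤ 1) : x ^ r * y ^ (1 - r) ≤ r * x + (1 - r) * y := by
  have h := rpow_one_add_le_one_add_mul_self (s := x / y - 1)
    (by linarith [div_pos hx hy]) h0 h1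
  rw [rpow_mul_rpow_one_sub_eq hx hy]
  calc _ ≤ y * (1 + r * (x / y - 1)) := mul_le_mul_of_nonneg_left h hy.le
    _ = _ := by field_simp; ring

theorem le_rpow_mul_rpow_one_sub {x y : ℝ} (hx : 0 < x) (hy : 0 < y) {r : ℝ}
    (h1 : 1 ≤ r) : r * x + (1 - r) * y ≤ x ^ r * y ^ (1 - r) := by
  have h := one_add_mul_self_le_rpow_one_add (s := x / y - 1)
    (by linarith [div_pos hx hy]) h1
  rw [rpow_mul_rpow_one_sub_eq hx hy]
  calc _ = y * (1 + r * (x / y - 1)) := by field_simp; ring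
    _ ≤ _ := mul_le_mul_of_nonneg_left h hy.le

theorem sum_doublyStochastic_mul_add {n : Type*} [Fintype n] {c : n → n → ℝ}
    (h1 : ∀ i, ∑ j, c i j = 1) (h2 : ∀ j, ∑ i, c i j = 1) (x y : n → ℝ) :
    ∑ i, ∑ j, c i j * (x i + y j) = ∑ i, x i + ∑ j, y j := by
  simp_rw [mul_add, Finset.sum_add_distrib, ← Finset.sum_mul, h1, one_mul]
  rw [Finset.sum_comm]
  simp_rw [← Finset.sum_mul, h2, one_mul]

theorem rpow_mul_rpow_one_sub_normalize {x y K T : ℝ} (hx : 0 < x) (hy : 0 < y) (hK : 0 < K)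
    (hT : 0 < T) (r : ℝ) : x ^ r * y ^ (1 - r) =
      K ^ r * T ^ (1 - r) * ((x / K) ^ r * (y / T) ^ (1 - r)) := by
  have := (Real.rpow_pos_of_pos hK r).ne'
  have := (Real.rpow_pos_of_pos hT (1 - r)).ne'
  rw [Real.div_rpow hx.le hK.le, Real.div_rpow hy.le hT.le]
  field_simp

/-- After scaling both spectra to sum 1, the doubly stochastic average of the linear Bernoulli bound
is r + (1 - r) = 1. -/
theorem sum_doublyStochastic_normalized {n : Type*} [Fintype n] {c : n → n → ℝ}
    (h1 : ∀ i, ∑ j, c i j = 1) (h2 : ∀ j, ∑ i, c i j = 1) {x y : n → ℝ}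
    (hK : 0 < ∑ i, x i) (hT : 0 < ∑ j, y j) (r : ℝ) :
    ∑ i, ∑ j, c i j * ((∑ i, x i) ^ r * (∑ j, y j) ^ (1 - r) *
      (r * (x i / ∑ i, x i) + (1 - r) * (y j / ∑ j, y j))) =
      (∑ i, x i) ^ r * (∑ j, y j) ^ (1 - r) := by
  simp_rw [mul_left_comm (c _ _), ← Finset.mul_sum]
  rw [sum_doublyStochastic_mul_add h1 h2 (fun i => r * (x i / ∑ i, x i))
    (fun j => (1 - r) * (y j / ∑ j, y j))]
  rw [← Finset.mul_sum, ← Finset.mul_sum, ← Finset.sum_div, ← Finset.sum_div, div_self hK.ne',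
    div_self hT.ne']
  ring

theorem Matrix.PosDef.re_trace_pos {n : Type*} [Fintype n] [Nonempty n]
    {A : Matrix n n ℂ} (hA : A.PosDef) : 0 < A.trace.re :=
  (Complex.pos_iff.1 hA.trace_pos).1

/-- Hölder's inequality `Tr (P ^ r Q ^ (1 - r)) ≤ (Tr P) ^ r (Tr Q) ^ (1 - r)`. -/
theorem trace_rpow_mul_rpow_one_sub_le {n : Type*} [Fintype n] [DecidableEq n] [Nonempty n]
    {P Q : Matrix n n ℂ} (hP : P.PosDef) (hQ : Q.PosDef) {r : ℝ} (h0 : 0 ≤ r) (h1 : r ≤ 1) :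
    (CFC.rpow P r * CFC.rpow Q (1 - r)).trace.re ≤ P.trace.re ^ r * Q.trace.re ^ (1 - r) := by
  have hK := hP.re_trace_pos
  have hT := hQ.re_trace_pos
  obtain ⟨c, x, y, hc, hx, hy, hc1, hc2, hPx, hQy, h⟩ := exists_trace_rpow_mul_rpow_eq_sum hP hQ
  rw [hPx] at hK
  rw [hQy] at hT
  rw [h, hPx, hQy]
  conv_rhs => rw [← sum_doublyStochastic_normalized hc1 hc2 hK hT]
  refine Finset.sum_le_sum fun i _ => Finset.sum_le_sum fun j _ =>
    mul_le_mul_of_nonneg_left ?_ (hc i j)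
  rw [rpow_mul_rpow_one_sub_normalize (hx i) (hy j) hK hT]
  exact mul_le_mul_of_nonneg_left
    (rpow_mul_rpow_one_sub_le (div_pos (hx i) hK) (div_pos (hy j) hT) h0 h1) (by positivity)

/-- The reverse Hölder inequality `(Tr P) ^ r (Tr Q) ^ (1 - r) ≤ Tr (P ^ r Q ^ (1 - r))`. -/
theorem le_trace_rpow_mul_rpow_one_sub {n : Type*} [Fintype n] [DecidableEq n] [Nonempty n]
    {P Q : Matrix n n ℂ} (hP : P.PosDef) (hQ : Q.PosDef) {r : ℝ} (h1 : 1 ≤ r) :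
    P.trace.re ^ r * Q.trace.re ^ (1 - r) ≤ (CFC.rpow P r * CFC.rpow Q (1 - r)).trace.re := by
  have hK := hP.re_trace_pos
  have hT := hQ.re_trace_pos
  obtain ⟨c, x, y, hc, hx, hy, hc1, hc2, hPx, hQy, h⟩ := exists_trace_rpow_mul_rpow_eq_sum hP hQ
  rw [hPx] at hK
  rw [hQy] at hT
  rw [h, hPx, hQy]
  conv_lhs => rw [← sum_doublyStochastic_normalized hc1 hc2 hK hT]
  refine Finset.sum_le_sum fun i _ => Finset.sum_le_sum fun j _ =>
    mul_le_mul_of_nonneg_left ?_ (hc i j)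
  rw [rpow_mul_rpow_one_sub_normalize (hx i) (hy j) hK hT]
  exact mul_le_mul_of_nonneg_left
    (le_rpow_mul_rpow_one_sub (div_pos (hx i) hK) (div_pos (hy j) hT) h1) (by positivity)

/-! ### Partial trace, ampliation and the lift -/

/-- The matrix of `C ↦ C ⊗ 1` on vectorized matrices. -/
def ampliation (a b : Type*) [DecidableEq a] [DecidableEq b] :
    Matrix ((a × b) × (a × b)) (a × a) ℂ :=
  Matrix.of fun x j => if x.1.1 = j.1 ∧ x.2.1 = j.2 ∧ x.1.2 = x.2.2 then 1 else 0

/-- Turns the trace functional into a quadratic form, where Jensen's operator inequality applies. -/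
theorem quadraticForm_kronecker_vec {n : Type*} [Fintype n] (A B C : Matrix n n ℂ)
    (hC : Cᴴ = C) : star (vec C) ⬝ᵥ ((Bᵀ ⊗ₖ A) *ᵥ vec C) = (C * B * C * A).trace := by
  rw [kronecker_mulVec_vec, star_vec_dotProduct_vec, transpose_transpose, hC, trace_mul_comm,
    Matrix.mul_assoc, Matrix.mul_assoc, Matrix.mul_assoc, trace_mul_comm A]
  simp only [Matrix.mul_assoc]

section Ampliation

variable {a b : Type*} [Fintype b]

theorem Matrix.PosSemidef.partialTraceB {X : Matrix (a × b) (a × b) ℂ} (hX : X.PosSemidef) :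
    (_root_.partialTraceB X).PosSemidef := by
  have : _root_.partialTraceB X = ∑ k, X.submatrix (fun i => (i, k)) (fun i => (i, k)) := by
    ext i j
    simp [_root_.partialTraceB, sum_apply]
  rw [this]
  exact posSemidef_sum _ fun k _ => hX.submatrix _

theorem Matrix.PosDef.partialTraceB [Nonempty b] {X : Matrix (a × b) (a × b) ℂ} (hX : X.PosDef) :
    (_root_.partialTraceB X).PosDef := by
  have : _root_.partialTraceB X = ∑ k, X.submatrix (fun i => (i, k)) (fun i => (i, k)) := by
    ext i j
    simp [_root_.partialTraceB, sum_apply]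
  rw [this]
  refine posDef_sum Finset.univ_nonempty fun k _ => hX.submatrix fun i j h => (Prod.ext_iff.1 h).1

theorem partialTraceB_transpose (X : Matrix (a × b) (a × b) ℂ) :
    partialTraceB Xᵀ = (partialTraceB X)ᵀ := rfl

variable [Fintype a] [DecidableEq b]

theorem partialTraceB_kronecker_one_mul_mul (C D : Matrix a a ℂ) (X : Matrix (a × b) (a × b) ℂ) :
    partialTraceB ((C ⊗ₖ (1 : Matrix b b ℂ)) * X * (D ⊗ₖ (1 : Matrix b b ℂ))) =
      C * partialTraceB X * D := by
  ext i j
  simp only [partialTraceB, of_apply, mul_apply, kroneckerMap_apply, one_apply,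
    Fintype.sum_prod_type, Finset.sum_mul, Finset.mul_sum, mul_ite, ite_mul, mul_one, mul_zero,
    zero_mul, Finset.sum_ite_eq, Finset.sum_ite_eq', Finset.mem_univ, if_true]
  rw [Finset.sum_comm]
  refine Finset.sum_congr rfl fun x _ => ?_
  rw [Finset.sum_comm]

theorem trace_kronecker_one_mul (C : Matrix a a ℂ) (X : Matrix (a × b) (a × b) ℂ) :
    ((C ⊗ₖ (1 : Matrix b b ℂ)) * X).trace = (C * partialTraceB X).trace := by
  simp only [partialTraceB, trace, diag_apply, of_apply, mul_apply, kroneckerMap_apply, one_apply,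
    Fintype.sum_prod_type, Finset.mul_sum, mul_ite, ite_mul, mul_one, mul_zero,
    zero_mul, Finset.sum_ite_eq, Finset.mem_univ, if_true]
  exact Finset.sum_congr rfl fun x _ => Finset.sum_comm

variable [DecidableEq a]

theorem ampliation_mulVec_vec {a b : Type*} [Fintype a] [DecidableEq a] [DecidableEq b]
    (C : Matrix a a ℂ) :
    ampliation a b *ᵥ vec C = vec (C ⊗ₖ (1 : Matrix b b ℂ)) := by
  ext ⟨⟨i', k'⟩, ⟨i, k⟩⟩
  simp [ampliation, mulVec, dotProduct, vec, Fintype.sum_prod_type, ite_and, one_apply, eq_comm]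

theorem mul_ampliation_apply {m : Type*} (K : Matrix m ((a × b) × (a × b)) ℂ) (x : m) (j : a × a) :
    (K * ampliation a b) x j = ∑ k, K x ((j.1, k), (j.2, k)) := by
  simp [ampliation, mul_apply, Fintype.sum_prod_type, ite_and]

theorem ampliation_conjTranspose_mul_apply {m : Type*} (K : Matrix ((a × b) × (a × b)) m ℂ)
    (j : a × a) (x : m) :
    ((ampliation a b)ᴴ * K) j x = ∑ k, K ((j.1, k), (j.2, k)) x := by
  simp [ampliation, mul_apply, Fintype.sum_prod_type, ite_and, apply_ite]

theorem ampliation_compression_kronecker_one (B : Matrix (a × b) (a × b) ℂ) (G : Matrix a a ℂ) :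
    (ampliation a b)ᴴ * (B ⊗ₖ (G ⊗ₖ (1 : Matrix b b ℂ))) * ampliation a b =
      partialTraceB B ⊗ₖ G := by
  ext ⟨i', i⟩ ⟨j', j⟩
  rw [mul_ampliation_apply]
  simp_rw [ampliation_conjTranspose_mul_apply]
  simp [partialTraceB, one_apply, Finset.sum_mul]

theorem ampliation_compression_one_kronecker (H : Matrix (a × b) (a × b) ℂ) :
    (ampliation a b)ᴴ * ((1 : Matrix (a × b) (a × b) ℂ) ⊗ₖ H) * ampliation a b =
      (1 : Matrix a a ℂ) ⊗ₖ partialTraceB H := by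
  ext ⟨i', i⟩ ⟨j', j⟩
  rw [mul_ampliation_apply]
  simp_rw [ampliation_conjTranspose_mul_apply]
  simp [partialTraceB, one_apply, Finset.mul_sum, ite_and]

variable {W : Matrix (a × b) (a × b) ℂ}

/-- Compression by the ampliation turns 1 ⊗ H into 1 ⊗ Tr_B H, so the isometry condition is
precisely that Wᴴ W has partial trace 1. -/
theorem isometry_kronecker_mul_ampliation (hW : partialTraceB (Wᴴ * W) = 1) :
    (((1 : Matrix (a × b) (a × b) ℂ) ⊗ₖ W) * ampliation a b)ᴴ *
      (((1 : Matrix (a × b) (a × b) ℂ) ⊗ₖ W) * ampliation a b) = 1 := by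
  rw [conjTranspose_mul, conjTranspose_kronecker, Matrix.mul_assoc, ← Matrix.mul_assoc _ _
    (ampliation a b), ← mul_kronecker_mul, conjTranspose_one, Matrix.one_mul, ← Matrix.mul_assoc,
    ampliation_compression_one_kronecker, hW, one_kronecker_one]

/-- Conjugation by W cancels the factors of W in the inverse, leaving τ⁻¹ ⊗ 1, whose identity factor
traces out B in Yᵀ. -/
theorem compression_kronecker_mul_ampliation (τ : Matrix a a ℂ) (hW : IsUnit W)
    (Y : Matrix (a × b) (a × b) ℂ) :
    (((1 : Matrix (a × b) (a × b) ℂ) ⊗ₖ W) * ampliation a b)ᴴ *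
      (Yᵀ ⊗ₖ (W * (τ ⊗ₖ (1 : Matrix b b ℂ)) * Wᴴ)⁻¹) *
      (((1 : Matrix (a × b) (a × b) ℂ) ⊗ₖ W) * ampliation a b) = (partialTraceB Y)ᵀ ⊗ₖ τ⁻¹ := by
  have hdet := (isUnit_iff_isUnit_det W).1 hW
  have hdet' : IsUnit Wᴴ.det := by rw [det_conjTranspose]; exact hdet.star
  have h : Wᴴ * (W * (τ ⊗ₖ (1 : Matrix b b ℂ)) * Wᴴ)⁻¹ * W = τ⁻¹ ⊗ₖ (1 : Matrix b b ℂ) := by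
    rw [Matrix.mul_inv_rev, Matrix.mul_inv_rev, inv_kronecker, inv_one]
    calc _ = (Wᴴ * Wᴴ⁻¹) * (τ⁻¹ ⊗ₖ (1 : Matrix b b ℂ)) * (W⁻¹ * W) := by
          simp only [Matrix.mul_assoc]
      _ = _ := by rw [mul_nonsing_inv _ hdet', nonsing_inv_mul _ hdet, Matrix.one_mul,
                    Matrix.mul_one]
  rw [← partialTraceB_transpose, ← ampliation_compression_kronecker_one, ← h, conjTranspose_mul,
    conjTranspose_kronecker, conjTranspose_one]
  calc _ = (ampliation a b)ᴴ * (((1 : Matrix (a × b) (a × b) ℂ) ⊗ₖ Wᴴ) *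
        (Yᵀ ⊗ₖ (W * (τ ⊗ₖ (1 : Matrix b b ℂ)) * Wᴴ)⁻¹) *
        ((1 : Matrix (a × b) (a × b) ℂ) ⊗ₖ W)) * ampliation a b := by
        simp only [Matrix.mul_assoc]
    _ = _ := by
      rw [← mul_kronecker_mul, ← mul_kronecker_mul, Matrix.one_mul, Matrix.mul_one]

theorem trace_lift (τ : Matrix a a ℂ) (hW : partialTraceB (Wᴴ * W) = 1) :
    (W * (τ ⊗ₖ (1 : Matrix b b ℂ)) * Wᴴ).trace = τ.trace := by
  rw [trace_mul_comm, ← Matrix.mul_assoc, trace_mul_comm, trace_kronecker_one_mul, hW,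
    Matrix.mul_one]

variable [Nonempty b]

/-- Every positive definite `τ` on the first factor lifts to a positive definite `σ` on the
product of the same trace, along which the trace functionals defining the optimized
`f`-divergences are monotone. -/
theorem exists_lift {X Y : Matrix (a × b) (a × b) ℂ} (hX : X.PosDef) (hY : Y.PosDef)
    {τ : Matrix a a ℂ} (hτ : τ.PosDef) :
    ∃ σ : Matrix (a × b) (a × b) ℂ, σ.PosDef ∧ σ.trace = τ.trace ∧ ∀ p ∈ Set.Ioc (0 : ℝ) 1,
      (CFC.rpow X (1 / 2) * CFC.rpow Y p * CFC.rpow X (1 / 2) * CFC.rpow σ (-p)).trace.re ≤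
        (CFC.rpow (partialTraceB X) (1 / 2) * CFC.rpow (partialTraceB Y) p *
          CFC.rpow (partialTraceB X) (1 / 2) * CFC.rpow τ (-p)).trace.re ∧
      (CFC.rpow (partialTraceB X) (1 / 2) * CFC.rpow (partialTraceB Y) (-p) *
          CFC.rpow (partialTraceB X) (1 / 2) * CFC.rpow τ p).trace.re ≤
        (CFC.rpow X (1 / 2) * CFC.rpow Y (-p) * CFC.rpow X (1 / 2) * CFC.rpow σ p).trace.re := by
  have hXA := hX.partialTraceB
  have hYA := hY.partialTraceB
  set C := CFC.rpow (partialTraceB X) (1 / 2) with hC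
  set D := CFC.rpow (partialTraceB X) (-(1 / 2)) with hD
  set R := CFC.rpow X (1 / 2) with hR
  have hCp : C.PosDef := hXA.rpow _
  have hDp : D.PosDef := hXA.rpow _
  have hRp : R.PosDef := hX.rpow _
  have hDC : D * C = 1 := by rw [hD, hC, hXA.rpow_add, neg_add_cancel, hXA.rpow_zero]
  have hCD : C * D = 1 := mul_eq_one_comm.1 hDC
  have hCC : C * C = partialTraceB X := by rw [hC, hXA.rpow_add, add_halves, hXA.rpow_one]
  have hRR : R * R = X := by rw [hR, hX.rpow_add, add_halves, hX.rpow_one]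
  -- Normalized so that Wᴴ W has partial trace X_A^(-1/2) X_A X_A^(-1/2) = 1.
  set W := R * (D ⊗ₖ (1 : Matrix b b ℂ)) with hWdef
  have hWu : IsUnit W := hRp.isUnit.mul (hDp.kronecker PosDef.one).isUnit
  have hW : partialTraceB (Wᴴ * W) = 1 := by
    have : Wᴴ * W = (D ⊗ₖ (1 : Matrix b b ℂ)) * X * (D ⊗ₖ (1 : Matrix b b ℂ)) := by
      rw [hWdef, conjTranspose_mul, conjTranspose_kronecker, conjTranspose_one,
        hDp.isHermitian.eq, hRp.isHermitian.eq, ← hRR]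
      simp only [Matrix.mul_assoc]
    rw [this, partialTraceB_kronecker_one_mul_mul, ← hCC, ← Matrix.mul_assoc, hDC,
      Matrix.one_mul, hCD]
  set σ := W * (τ ⊗ₖ (1 : Matrix b b ℂ)) * Wᴴ with hσdef
  have hσ : σ.PosDef :=
    (hτ.kronecker PosDef.one).mul_mul_conjTranspose_same (vecMul_injective_of_isUnit hWu)
  set V := ((1 : Matrix (a × b) (a × b) ℂ) ⊗ₖ W) * ampliation a b with hVdef
  have hV : Vᴴ * V = 1 := isometry_kronecker_mul_ampliation hW
  have hcomp : Vᴴ * (Yᵀ ⊗ₖ σ⁻¹) * V = (partialTraceB Y)ᵀ ⊗ₖ τ⁻¹ :=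
    compression_kronecker_mul_ampliation τ hWu Y
  -- The factor X_A^(-1/2) in W cancels C, leaving X^(1/2).
  have hvec : V *ᵥ vec C = vec R := by
    rw [hVdef, ← mulVec_mulVec, ampliation_mulVec_vec, ← vec_mul_eq_mulVec, hWdef,
      Matrix.mul_assoc, ← mul_kronecker_mul, hDC, Matrix.one_mul, one_kronecker_one,
      Matrix.mul_one]
  have hM : (Yᵀ ⊗ₖ σ⁻¹).PosDef := hY.transpose.kronecker hσ.inv
  have hMp : ∀ s, CFC.rpow (Yᵀ ⊗ₖ σ⁻¹) s = (CFC.rpow Y s)ᵀ ⊗ₖ CFC.rpow σ (-s) := by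
    intro s
    rw [hY.transpose.rpow_kronecker hσ.inv, hY.rpow_transpose, ← hσ.rpow_neg_one, hσ.rpow_rpow,
      neg_one_mul]
  have hNp : ∀ s, CFC.rpow ((partialTraceB Y)ᵀ ⊗ₖ τ⁻¹) s =
      (CFC.rpow (partialTraceB Y) s)ᵀ ⊗ₖ CFC.rpow τ (-s) := by
    intro s
    rw [hYA.transpose.rpow_kronecker hτ.inv, hYA.rpow_transpose, ← hτ.rpow_neg_one, hτ.rpow_rpow,
      neg_one_mul]
  have hq : ∀ K : Matrix ((a × b) × (a × b)) ((a × b) × (a × b)) ℂ,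
      star (vec C) ⬝ᵥ ((Vᴴ * K * V) *ᵥ vec C) = star (vec R) ⬝ᵥ (K *ᵥ vec R) := by
    intro K
    rw [← hvec, star_mulVec, ← dotProduct_mulVec, mulVec_mulVec, mulVec_mulVec, Matrix.mul_assoc]
  refine ⟨σ, hσ, trace_lift τ hW, fun p hp => ⟨?_, ?_⟩⟩
  · have h := (Complex.nonneg_iff.1
      ((posSemidef_rpow_compression_sub hM hV hp).dotProduct_mulVec_nonneg (vec C))).1
    rw [sub_mulVec, dotProduct_sub, hq, hcomp, hMp, hNp,
      quadraticForm_kronecker_vec _ _ _ hCp.isHermitian.eq,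
      quadraticForm_kronecker_vec _ _ _ hRp.isHermitian.eq, Complex.sub_re] at h
    linarith
  · have h := (Complex.nonneg_iff.1
      ((posSemidef_compression_rpow_neg_sub hM hV hp).dotProduct_mulVec_nonneg (vec C))).1
    rw [sub_mulVec, dotProduct_sub, hq, hcomp, hMp, hNp, neg_neg,
      quadraticForm_kronecker_vec _ _ _ hCp.isHermitian.eq,
      quadraticForm_kronecker_vec _ _ _ hRp.isHermitian.eq, Complex.sub_re] at h
    linarith

end Ampliation

/-! ### Trace form of the entropy for finite α -/

section Renyi

variable {n : Type*} [Fintype n] [DecidableEq n]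

theorem Matrix.PosDef.sandwich {A B : Matrix n n ℂ} (hA : A.PosDef) (hB : B.PosDef) :
    (A * B * A).PosDef := by
  have h := hB.conjTranspose_mul_mul_same (mulVec_injective_of_isUnit hA.isUnit)
  rwa [hA.isHermitian.eq] at h

/-- With M = Y^s X^(1/2), the two sandwiches are M Mᴴ and Mᴴ M. -/
theorem trace_rpow_sandwich {X Y : Matrix n n ℂ} (hX : X.PosDef) (hY : Y.PosDef) (s α : ℝ) :
    (CFC.rpow (CFC.rpow Y s * X * CFC.rpow Y s) α).trace =
      (CFC.rpow (CFC.rpow X (1 / 2) * CFC.rpow Y (2 * s) * CFC.rpow X (1 / 2)) α).trace := by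
  have h1 : CFC.rpow Y s * X * CFC.rpow Y s =
      (CFC.rpow Y s * CFC.rpow X (1 / 2)) * (CFC.rpow X (1 / 2) * CFC.rpow Y s) := by
    rw [Matrix.mul_assoc, Matrix.mul_assoc, ← Matrix.mul_assoc (CFC.rpow X _), hX.rpow_add,
      add_halves, hX.rpow_one]
  have h2 : CFC.rpow X (1 / 2) * CFC.rpow Y (2 * s) * CFC.rpow X (1 / 2) =
      (CFC.rpow X (1 / 2) * CFC.rpow Y s) * (CFC.rpow Y s * CFC.rpow X (1 / 2)) := by
    rw [Matrix.mul_assoc, Matrix.mul_assoc, ← Matrix.mul_assoc (CFC.rpow Y s), hY.rpow_add,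
      two_mul]
  have p1 := (hY.rpow s).sandwich hX
  have p2 := (hX.rpow (1 / 2)).sandwich (hY.rpow (2 * s))
  rw [h1] at p1 ⊢
  rw [h2] at p2 ⊢
  exact p1.trace_rpow_mul_comm p2 α

/-- `Tr ((X ^ (1/2) Y ^ (1/α - 1) X ^ (1/2)) ^ α)`, the quantity underlying the sandwiched Rényi
relative entropy. -/
noncomputable def renyiTrace (α : ℝ) (X Y : Matrix n n ℂ) : ℝ :=
  (CFC.rpow (CFC.rpow X (1 / 2) * CFC.rpow Y (1 / α - 1) * CFC.rpow X (1 / 2)) α).trace.re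

theorem renyiTrace_pos [Nonempty n] {X Y : Matrix n n ℂ} (hX : X.PosDef) (hY : Y.PosDef)
    (α : ℝ) : 0 < renyiTrace α X Y :=
  (((hX.rpow _).sandwich (hY.rpow _)).rpow α).re_trace_pos

theorem sandwichedRenyi_eq {X Y : Matrix n n ℂ} (hX : X.PosDef) (hY : Y.PosDef) {α : ℝ≥0∞}
    (hα : α ≠ ∞) (h0 : α.toReal ≠ 0) : sandwichedRenyi α X Y =
      α.toReal / (α.toReal - 1) * Real.log (renyiTrace α.toReal X Y ^ (1 / α.toReal)) := by
  have h : 2 * ((1 - α.toReal) / (2 * α.toReal)) = 1 / α.toReal - 1 := by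
    field_simp
  simp only [sandwichedRenyi, sandwichPrefactor, schattenNorm, sandwichExponent, if_neg hα]
  rw [trace_rpow_sandwich hX hY, h, renyiTrace]

end Renyi

/-! ### Monotonicity for finite α -/

section Monotonicity

variable {a b : Type*} [Fintype a] [DecidableEq a] [Nonempty a]
  [Fintype b] [DecidableEq b] [Nonempty b] {X Y : Matrix (a × b) (a × b) ℂ}

theorem renyiTrace_partialTraceB_le (hX : X.PosDef) (hY : Y.PosDef) {α : ℝ} (hα : 1 < α) :
    renyiTrace α (partialTraceB X) (partialTraceB Y) ^ (1 / α) ≤ renyiTrace α X Y ^ (1 / α) := by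
  have h0 : 0 < α := by linarith
  have hr0 : 0 < 1 / α := by positivity
  have hr1 : 1 / α < 1 := (div_lt_one h0).2 hα
  have hZA := (hX.partialTraceB.rpow (1 / 2)).sandwich (hY.partialTraceB.rpow (1 / α - 1))
  have hZ := (hX.rpow (1 / 2)).sandwich (hY.rpow (1 / α - 1))
  -- The lifted τ = Z_A^α is the unnormalized Hölder optimizer: Tr(Z_A τ^(1-1/α)) = Tr Z_A^α.
  obtain ⟨σ, hσ, htr, h⟩ := exists_lift hX hY (hZA.rpow α)
  have h1 := (h (1 - 1 / α) ⟨by linarith, by linarith⟩).2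
  have h2 := trace_rpow_mul_rpow_one_sub_le (hZ.rpow α) hσ hr0.le hr1.le
  rw [hZ.rpow_rpow, mul_one_div_cancel h0.ne', hZ.rpow_one, htr] at h2
  rw [neg_sub, hZA.rpow_rpow] at h1
  nth_rewrite 1 [← hZA.rpow_one] at h1
  rw [hZA.rpow_add, show 1 + α * (1 - 1 / α) = α by field_simp; ring] at h1
  have h3 := h1.trans h2
  have hpos := renyiTrace_pos hX.partialTraceB hY.partialTraceB α
  change renyiTrace α (partialTraceB X) (partialTraceB Y) ≤ renyiTrace α X Y ^ (1 / α) *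
    renyiTrace α (partialTraceB X) (partialTraceB Y) ^ (1 - 1 / α) at h3
  rw [Real.rpow_sub hpos, Real.rpow_one, ← mul_div_assoc,
    le_div_iff₀ (Real.rpow_pos_of_pos hpos _), mul_comm] at h3
  exact le_of_mul_le_mul_right h3 hpos

theorem le_renyiTrace_partialTraceB (hX : X.PosDef) (hY : Y.PosDef) {α : ℝ} (hα : 1 / 2 ≤ α)
    (hα1 : α < 1) :
    renyiTrace α X Y ^ (1 / α) ≤ renyiTrace α (partialTraceB X) (partialTraceB Y) ^ (1 / α) := by
  have h0 : 0 < α := by linarith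
  have hr1 : 1 < 1 / α := (one_lt_div h0).2 hα1
  have hr2 : 1 / α ≤ 2 := (div_le_iff₀ h0).2 (by linarith)
  have hZA := (hX.partialTraceB.rpow (1 / 2)).sandwich (hY.partialTraceB.rpow (1 / α - 1))
  have hZ := (hX.rpow (1 / 2)).sandwich (hY.rpow (1 / α - 1))
  obtain ⟨σ, hσ, htr, h⟩ := exists_lift hX hY (hZA.rpow α)
  -- The bound α ≥ 1/2 is what gives 1/α - 1 ≤ 1, the range of Jensen's inequality.
  have h1 := (h (1 / α - 1) ⟨by linarith, by linarith⟩).1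
  have h2 := le_trace_rpow_mul_rpow_one_sub (hZ.rpow α) hσ hr1.le
  rw [hZ.rpow_rpow, mul_one_div_cancel h0.ne', hZ.rpow_one, htr] at h2
  rw [neg_sub, hZA.rpow_rpow] at h1
  nth_rewrite 1 [← hZA.rpow_one] at h1
  rw [hZA.rpow_add, show 1 + α * (1 - 1 / α) = α by field_simp; ring] at h1
  have h3 := h2.trans h1
  have hpos := renyiTrace_pos hX.partialTraceB hY.partialTraceB α
  change renyiTrace α X Y ^ (1 / α) *
    renyiTrace α (partialTraceB X) (partialTraceB Y) ^ (1 - 1 / α) ≤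
    renyiTrace α (partialTraceB X) (partialTraceB Y) at h3
  rw [Real.rpow_sub hpos, Real.rpow_one, ← mul_div_assoc,
    div_le_iff₀ (Real.rpow_pos_of_pos hpos _), mul_comm] at h3
  exact le_of_mul_le_mul_left h3 hpos

end Monotonicity

/-! ### The case α = ∞ and the conclusion -/

open scoped Matrix.Norms.L2Operator in
theorem norm_toEuclideanCLM_le_iff {n : Type*} [Fintype n] [DecidableEq n] {Z : Matrix n n ℂ}
    (hZ : Z.PosSemidef) {r : ℝ} (hr : 0 ≤ r) :
    ‖Matrix.toEuclideanCLM (n := n) (𝕜 := ℂ) Z‖ ≤ r ↔ ((r : ℂ) • 1 - Z).PosSemidef := by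
  rw [← cstar_norm_def, CStarAlgebra.norm_le_iff_le_algebraMap Z hr
    (Matrix.nonneg_iff_posSemidef.2 hZ), Matrix.le_iff, Algebra.algebraMap_eq_smul_one]
  rfl

/-- Conjugating by Y^(1/2) or Y^(-1/2) preserves positivity and passes between the two forms. -/
theorem posSemidef_smul_one_sub_sandwich_iff {n : Type*} [Fintype n] [DecidableEq n]
    {X Y : Matrix n n ℂ} (hY : Y.PosDef) (r : ℂ) :
    (r • 1 - CFC.rpow Y (-1 / 2) * X * CFC.rpow Y (-1 / 2)).PosSemidef ↔
      (r • Y - X).PosSemidef := by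
  have h1 : CFC.rpow Y (-1 / 2) * CFC.rpow Y (1 / 2) = 1 := by
    rw [hY.rpow_add, neg_div, neg_add_cancel, hY.rpow_zero]
  have h3 : CFC.rpow Y (1 / 2) * CFC.rpow Y (1 / 2) = Y := by
    rw [hY.rpow_add, add_halves, hY.rpow_one]
  set S := CFC.rpow Y (-1 / 2) with hS
  set R := CFC.rpow Y (1 / 2) with hR
  have h2 : R * S = 1 := mul_eq_one_comm.1 h1
  have hSh : Sᴴ = S := (hY.rpow _).isHermitian.eq
  have hRh : Rᴴ = R := (hY.rpow _).isHermitian.eq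
  constructor <;> intro h
  · have h' := h.conjTranspose_mul_mul_same R
    rw [hRh, Matrix.mul_sub, Matrix.sub_mul, Matrix.mul_smul, Matrix.smul_mul, Matrix.mul_one,
      h3] at h'
    have e : R * (S * X * S) * R = (R * S) * X * (S * R) := by simp only [Matrix.mul_assoc]
    rwa [e, h1, h2, Matrix.one_mul, Matrix.mul_one] at h'
  · have h' := h.conjTranspose_mul_mul_same S
    have e : S * Y * S = (S * R) * (R * S) := by
      rw [← h3]; simp only [Matrix.mul_assoc]
    rwa [hSh, Matrix.mul_sub, Matrix.sub_mul, Matrix.mul_smul, Matrix.smul_mul, e, h1, h2,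
      Matrix.one_mul] at h'

theorem sandwichedRenyi_top_partialTraceB_le {a b : Type*} [Fintype a] [DecidableEq a] [Nonempty a]
    [Fintype b] [DecidableEq b] [Nonempty b] {X Y : Matrix (a × b) (a × b) ℂ} (hX : X.PosDef)
    (hY : Y.PosDef) :
    sandwichedRenyi ∞ (partialTraceB X) (partialTraceB Y) ≤ sandwichedRenyi ∞ X Y := by
  have hZA := (hY.partialTraceB.rpow (-1 / 2)).sandwich hX.partialTraceB
  have hZ := (hY.rpow (-1 / 2)).sandwich hX
  simp only [sandwichedRenyi, sandwichPrefactor, schattenNorm, sandwichExponent, if_true, one_mul]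
  refine Real.log_le_log ?_ ?_
  · rw [norm_pos_iff]
    intro h
    rw [EmbeddingLike.map_eq_zero_iff] at h
    have := hZA.re_trace_pos
    rw [h, trace_zero, Complex.zero_re] at this
    exact lt_irrefl _ this
  · rw [norm_toEuclideanCLM_le_iff hZA.posSemidef (norm_nonneg _),
      posSemidef_smul_one_sub_sandwich_iff hY.partialTraceB]
    have h := (norm_toEuclideanCLM_le_iff hZ.posSemidef (norm_nonneg _)).1 le_rfl
    have h' := ((posSemidef_smul_one_sub_sandwich_iff hY _).1 h).partialTraceB
    convert h' using 1
    ext i j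
    simp [partialTraceB, Finset.mul_sum, Finset.sum_sub_distrib]

theorem mainTheorem5 {a b : Type*} [Fintype a] [DecidableEq a] [Nonempty a]
    [Fintype b] [DecidableEq b] [Nonempty b]
    (α : ℝ≥0∞) (hα : α ∈ Set.Ico (1 / 2 : ℝ≥0∞) 1 ∪ Set.Ioc 1 ∞)
    (X Y : Matrix (a × b) (a × b) ℂ) (hX : X.PosDef) (hY : Y.PosDef) :
    sandwichedRenyi α (partialTraceB X) (partialTraceB Y) ≤ sandwichedRenyi α X Y := by
  rcases eq_or_ne α ∞ with rfl | htop
  · exact sandwichedRenyi_top_partialTraceB_le hX hY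
  have hXA := hX.partialTraceB
  have hYA := hY.partialTraceB
  rcases hα with ⟨h1, h2⟩ | ⟨h1, -⟩
  · have h1' : 1 / 2 ≤ α.toReal := by
      have := ENNReal.toReal_mono htop h1
      simpa using this
    have h2' : α.toReal < 1 := by
      have := (ENNReal.toReal_lt_toReal htop ENNReal.one_ne_top).2 h2
      simpa using this
    have h0 : 0 < α.toReal := by linarith
    rw [sandwichedRenyi_eq hX hY htop h0.ne', sandwichedRenyi_eq hXA hYA htop h0.ne']
    -- For α < 1 the prefactor is negative and reverses the trace inequality.
    refine mul_le_mul_of_nonpos_left (Real.log_le_log ?_ ?_)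
      (div_nonpos_of_nonneg_of_nonpos h0.le (by linarith))
    · exact Real.rpow_pos_of_pos (renyiTrace_pos hX hY _) _
    · exact le_renyiTrace_partialTraceB hX hY h1' h2'
  · have h1' : 1 < α.toReal := by
      have := (ENNReal.toReal_lt_toReal ENNReal.one_ne_top htop).2 h1
      simpa using this
    have h0 : 0 < α.toReal := by linarith
    rw [sandwichedRenyi_eq hX hY htop h0.ne', sandwichedRenyi_eq hXA hYA htop h0.ne']
    refine mul_le_mul_of_nonneg_left (Real.log_le_log ?_ ?_)
      (div_nonneg h0.le (by linarith))
    · exact Real.rpow_pos_of_pos (renyiTrace_pos hXA hYA _) _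
    · exact renyiTrace_partialTraceB_le hX hY h1'
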